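/- Let $\mathbb S$ be the unit sphere of $\mathbb R^3$ with its uniform (surface) measure $d\xi$ of total mass $4\pi$, and let $(X(\xi))_{\xi\in\mathbb S}$ be a real-valued, measurable, square integrable, zero-mean random field which is mean square continuous and second-order stationary, i.e. $\mathbf E[X(\rho\xi)X(\rho\xi')]=\mathbf E[X(\xi)X(\xi')]$ for all $\xi,\xi'\in\mathbb S$ and $\rho\in SO(3)$. Let $a_{\ell,m}=\int_{\mathbb S}X(\xi)\overline{\mathcal Y_{\ell,m}(\xi)}\,d\xi$ be its coefficients in the usual orthonormal spherical harmonics $\mathcal Y_{\ell,m}$ ($\ell\ge 0$, $-\ell\le m\le \ell$), and let $(C_\ell)_{\ell\ge0}$ be its angular power spectrum, that is, the sequence for which $\mathbf E[a_{\ell,m}\overline{a_{\ell',m'}}]=\delta_{\ell,\ell'}\delta_{m,m'}C_\ell$ for $m,m'\ge0$; in particular $C_\ell=\mathbf E|a_{\ell,0}|^2$. Let $L_\ell$ be the Legendre polynomial of degree $\ell$ normalized by $L_\ell(1)=\frac{2\ell+1}{4\pi}$. For every scale $j\in\mathbb N$ let $b_j=(b_{j,\ell})_{\ell\ge0}$ be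 a real sequence with $b_{j,\ell}=0$ for $\ell>L_j^{(b)}$, where $L_j^{(b)}\in\mathbb N$, and let $\xi_{j,k}\in\mathbb S$ and $\lambda_{j,k}>0$, $1\le k\le N_j$, be finitely many points and weights (for instance the cubature points and weights of a pixelization of the sphere). The needlets are $\psi_{j,k}(\xi)=\sqrt{\lambda_{j,k}}\sum_{\ell\ge0}b_{j,\ell}L_\ell(\xi\cdot\xi_{j,k})$, and the needlet coefficients of $X$ are $\eta_{j,k}=\lambda_{j,k}^{-1/2}\int_{\mathbb S}X(\xi)\psi_{j,k}(\xi)\,d\xi$. Then the $\eta_{j,k}$ are square integrable and centered, $\mathbf E[\eta_{j,k}]=0$, and for all $j\in\mathbb N$ and $k,k'\in\{1,\dots,N_j\}$ $$\operatorname{Cov}[\eta_{j,k},\eta_{j,k'}]=\sum_{\ell\ge0}(b_{j,\ell})^2\,C_\ell\,L_\ell(\xi_{j,k}\cdot\xi_{j,k'}).$$ -/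

import Mathlib

open MeasureTheory ProbabilityTheory Filter Topology

noncomputable section

namespace Needlet

/-- Euclidean space `ℝ³`. -/
abbrev E3 : Type := EuclideanSpace ℝ (Fin 3)

/-- The unit sphere of `ℝ³`. -/
abbrev S2 : Type := Metric.sphere (0 : E3) 1

/-- The uniform measure `dξ` on the sphere (the surface measure, rotation invariant, of total
mass `4π`). -/
def sphereMeasure : Measure S2 := (volume : Measure E3).toSphere

/-- The dot product `ξ · ξ'` of two points of the sphere, as vectors of `ℝ³`. -/
def dot (x y : S2) : ℝ := inner ℝ (x : E3) (y : E3)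

/-- The classical Legendre polynomial `P_ℓ` (Rodrigues' formula), for which `P_ℓ(1) = 1`. -/
def legendreP (l : ℕ) : Polynomial ℝ :=
  Polynomial.C ((2 ^ l * (l.factorial : ℝ))⁻¹) *
    Polynomial.derivative^[l] ((Polynomial.X ^ 2 - 1) ^ l)

/-- The Legendre polynomial of degree `ℓ` normalized by `L_ℓ(1) = (2ℓ + 1) / (4π)`. -/
def legendreL (l : ℕ) : Polynomial ℝ :=
  Polynomial.C ((2 * (l : ℝ) + 1) / (4 * Real.pi)) * legendreP l

/-- The usual orthonormal spherical harmonic `Y_{ℓ,m}`, `-ℓ ≤ m ≤ ℓ`, in Cartesian coordinates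
`ξ = (x, y, z) = (sin θ cos φ, sin θ sin φ, cos θ)`, for which
`sin^{|m|} θ e^{i m φ} = (x ± i y)^{|m|}`. The phase is the one with
`Y_{ℓ,-m} = conj Y_{ℓ,m}`. -/
def sphericalHarmonic (l : ℕ) (m : ℤ) (x : S2) : ℂ :=
  (Real.sqrt ((2 * (l : ℝ) + 1) / (4 * Real.pi) *
      (((l - m.natAbs).factorial : ℝ) / ((l + m.natAbs).factorial : ℝ))) : ℂ) *
    (((x : E3) 0 : ℂ) + (m.sign : ℂ) * Complex.I * ((x : E3) 1 : ℂ)) ^ m.natAbs *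
    (((Polynomial.derivative^[m.natAbs] (legendreP l)).eval ((x : E3) 2) : ℝ) : ℂ)

/-- The action on the sphere of a linear isometry of `ℝ³`. -/
def rotate (ρ : E3 ≃ₗᵢ[ℝ] E3) (x : S2) : S2 := ⟨ρ x, by simp⟩

section Field

variable {Ω : Type*} [MeasurableSpace Ω]

/-- A zero-mean, mean square continuous, second-order stationary real random field on the sphere.
A rotation (an element of `SO(3)`) is a linear isometry of `ℝ³` of determinant `1`. The
measurability makes the integrals of the sample paths over the sphere random variables. -/
structure IsStationaryField (P : Measure Ω) (X : S2 → Ω → ℝ) : Prop where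
  aestronglyMeasurable :
    AEStronglyMeasurable (fun q : S2 × Ω => X q.1 q.2) (sphereMeasure.prod P)
  memLp : ∀ x, MemLp (X x) 2 P
  mean_zero : ∀ x, ∫ ω, X x ω ∂P = 0
  mean_square_continuous :
    ∀ x, Tendsto (fun y => ∫ ω, (X y ω - X x ω) ^ 2 ∂P) (𝓝 x) (𝓝 0)
  stationary : ∀ ρ : E3 ≃ₗᵢ[ℝ] E3, LinearMap.det (ρ.toLinearEquiv : E3 →ₗ[ℝ] E3) = 1 →
    ∀ x y, ∫ ω, X (rotate ρ x) ω * X (rotate ρ y) ω ∂P = ∫ ω, X x ω * X y ω ∂P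

/-- The (random) spherical harmonics coefficient `a_{ℓ,m} = ⟨X, Y_{ℓ,m}⟩` in `L²(dξ)`. -/
def harmonicCoeff (X : S2 → Ω → ℝ) (l : ℕ) (m : ℤ) (ω : Ω) : ℂ :=
  ∫ x, (X x ω : ℂ) * (starRingEnd ℂ) (sphericalHarmonic l m x) ∂sphereMeasure

/-- The angular power spectrum `C_ℓ` of a stationary field. The relation
`E[a_{ℓ,m} conj a_{ℓ',m'}] = δ_{ℓ,ℓ'} δ_{m,m'} C_ℓ` that characterizes it forces
`C_ℓ = E |a_{ℓ,0}|²`; the other instances of the relation are not presupposed here. -/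
def powerSpectrum (P : Measure Ω) (X : S2 → Ω → ℝ) (l : ℕ) : ℝ :=
  ∫ ω, ‖harmonicCoeff X l 0 ω‖ ^ 2 ∂P

/-- The needlet with window `b`, centre `c` and weight `w`:
`ψ(ξ) = √w ∑_ℓ b_ℓ L_ℓ(ξ · c)` (a finite sum for a window of bounded support). -/
def needlet (b : ℕ → ℝ) (c : S2) (w : ℝ) (x : S2) : ℝ :=
  Real.sqrt w * ∑' l : ℕ, b l * (legendreL l).eval (dot x c)

/-- The (renormalized) needlet coefficient `w^{-1/2} ⟨X, ψ⟩` of the random field `X`. -/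
def needletCoeff (b : ℕ → ℝ) (c : S2) (w : ℝ) (X : S2 → Ω → ℝ) (ω : Ω) : ℝ :=
  (Real.sqrt w)⁻¹ * ∫ x, X x ω * needlet b c w x ∂sphereMeasure

end Field

end Needlet

end

/-! A needlet coefficient is the integral of `X` against a zonal polynomial, so by Fubini the
covariance of two of them is a double integral of the covariance kernel against two zonal
polynomials. Stationarity makes the kernel rotation invariant, so the zonal Legendre functions are
eigenfunctions of the covariance operator (Funk–Hecke, `exists_integral_kernel_mul_legendreP`).
Computing `E|a_{ℓ,0}|²` identifies the eigenvalue as `C_ℓ` (`integral_covKernel_mul_legendreL`), and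
the reproducing property `integral_legendreL_mul_legendreL` reduces the remaining double sum to its
diagonal.

Funk–Hecke needs no addition theorem. An invariant symmetric kernel sends zonal polynomials of
degree at most `n` to zonal polynomials of degree at most `n`; by self-adjointness the image of
`P_n` is orthogonal to all lower degrees, hence a multiple of `P_n`. Archimedes' formula
`integral_eval_dot` turns orthogonality on the sphere into orthogonality on `[-1, 1]`. -/

namespace Needlet

/-! ### Legendre polynomials on `[-1, 1]` -/

section Legendre

open Polynomial

lemma eval_iterate_derivative_X_sub_C_pow_mul_of_lt {k n : ℕ} (h : k < n) (a : ℝ) (g : ℝ[X]) :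
    (derivative^[k] ((X - C a) ^ n * g)).eval a = 0 := by
  have h1 : (X - C a) ^ (n - k) ∣ derivative^[k] ((X - C a) ^ n * g) :=
    pow_sub_dvd_iterate_derivative_of_pow_dvd k (dvd_mul_right _ _)
  have h2 : (X - C a) ∣ derivative^[k] ((X - C a) ^ n * g) :=
    (dvd_pow_self _ (by omega)).trans h1
  exact dvd_iff_isRoot.mp h2

lemma eval_iterate_derivative_X_sub_C_pow_mul (n : ℕ) (a : ℝ) (g : ℝ[X]) :
    (derivative^[n] ((X - C a) ^ n * g)).eval a = n.factorial * g.eval a := by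
  induction n generalizing g with
  | zero => simp
  | succ n ih =>
    have h : derivative ((X - C a) ^ (n + 1) * g) =
        (X - C a) ^ n * (C ((n : ℝ) + 1) * g + (X - C a) * derivative g) := by
      simp only [derivative_mul, derivative_X_sub_C_pow, Nat.add_sub_cancel, map_add,
        map_natCast, map_one, Nat.cast_add, Nat.cast_one]
      ring
    rw [Function.iterate_succ_apply, h, ih, Nat.factorial_succ]
    simp
    ring

lemma X_sq_sub_one_pow (n : ℕ) :
    ((X : ℝ[X]) ^ 2 - 1) ^ n = (X - C 1) ^ n * (X + 1) ^ n := by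
  rw [← mul_pow]
  congr 1
  simp
  ring

lemma X_sq_sub_one_pow_eq_at_neg_one (n : ℕ) :
    ((X : ℝ[X]) ^ 2 - 1) ^ n = (X - C (-1)) ^ n * (X - 1) ^ n := by
  rw [← mul_pow]
  congr 1
  simp
  ring

lemma legendreP_eval_one (n : ℕ) : (legendreP n).eval 1 = 1 := by
  have : (2 : ℝ) ^ n * n.factorial ≠ 0 := by positivity
  rw [legendreP, eval_mul, eval_C, X_sq_sub_one_pow, eval_iterate_derivative_X_sub_C_pow_mul]
  simp only [eval_pow, eval_add, eval_X, eval_one]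
  field_simp
  norm_num

lemma legendreP_eval_neg_one_sq (n : ℕ) : (legendreP n).eval (-1) ^ 2 = 1 := by
  have : (2 : ℝ) ^ n * n.factorial ≠ 0 := by positivity
  have h : (legendreP n).eval (-1) = (-1) ^ n := by
    rw [legendreP, eval_mul, eval_C, X_sq_sub_one_pow_eq_at_neg_one, eval_iterate_derivative_X_sub_C_pow_mul]
    simp only [eval_pow, eval_sub, eval_X, eval_one]
    rw [show (-1 - 1 : ℝ) = (-1) * 2 by norm_num, mul_pow]
    field_simp
  rw [h, ← pow_mul, mul_comm, pow_mul]
  norm_num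

lemma natDegree_X_sq_sub_one_pow (n : ℕ) : (((X : ℝ[X]) ^ 2 - 1) ^ n).natDegree = 2 * n := by
  rw [natDegree_pow, ← C_1, natDegree_X_pow_sub_C, mul_comm]

lemma natDegree_legendreP_le (n : ℕ) : (legendreP n).natDegree ≤ n := by
  refine (natDegree_C_mul_le _ _).trans ((natDegree_iterate_derivative _ _).trans ?_)
  rw [natDegree_X_sq_sub_one_pow]
  omega

/-- The integral of a polynomial over `[-1, 1]`. -/
noncomputable def segmentIntegral (p : ℝ[X]) : ℝ := ∫ t in (-1 : ℝ)..1, p.eval t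

lemma segmentIntegral_add (p q : ℝ[X]) :
    segmentIntegral (p + q) = segmentIntegral p + segmentIntegral q := by
  simp only [segmentIntegral, eval_add]
  exact intervalIntegral.integral_add (p.continuous.intervalIntegrable _ _)
    (q.continuous.intervalIntegrable _ _)

lemma segmentIntegral_C_mul (a : ℝ) (p : ℝ[X]) :
    segmentIntegral (C a * p) = a * segmentIntegral p := by
  simp [segmentIntegral]

lemma segmentIntegral_derivative (p : ℝ[X]) :
    segmentIntegral (derivative p) = p.eval 1 - p.eval (-1) :=
  intervalIntegral.integral_eq_sub_of_hasDerivAt (fun x _ => p.hasDerivAt x)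
    ((derivative p).continuous.intervalIntegrable _ _)

lemma eq_zero_of_segmentIntegral_mul_self {p : ℝ[X]} (h : segmentIntegral (p * p) = 0) :
    p = 0 := by
  by_contra hp
  have hc : ContinuousOn (fun t => (p * p).eval t) (Set.Icc (-1) 1) :=
    (p * p).continuous.continuousOn
  have hz : ∀ t ∈ Set.Icc (-1 : ℝ) 1, p.eval t = 0 := by
    intro t ht
    by_contra hne
    have : 0 < ∫ t in (-1 : ℝ)..1, (p * p).eval t := by
      refine intervalIntegral.integral_pos (by norm_num) hc (fun x _ => ?_) ⟨t, ht, ?_⟩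
      · rw [eval_mul]; exact mul_self_nonneg _
      · rw [eval_mul]; exact mul_self_pos.mpr hne
    exact this.ne' h
  exact hp (eq_zero_of_infinite_isRoot p
    ((Set.Icc_infinite (by norm_num : (-1 : ℝ) < 1)).mono hz))

/-- Integration by parts, `k` times: the boundary terms vanish because `(X ^ 2 - 1) ^ n` has zeros
of order `n` at both endpoints. -/
lemma segmentIntegral_iterate_derivative_mul {n k : ℕ} (hk : k ≤ n) (p : ℝ[X])
    (hp : p.degree < k) :
    segmentIntegral (derivative^[k] ((X ^ 2 - 1) ^ n) * p) = 0 := by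
  induction k generalizing p with
  | zero =>
    have : p = 0 := by simpa using hp
    simp [this, segmentIntegral]
  | succ k ih =>
    have hd : (derivative p).degree < k := by
      rw [degree_lt_iff_coeff_zero] at hp ⊢
      intro m hm
      rw [coeff_derivative, hp (m + 1) (by omega), zero_mul]
    have h0 := ih (by omega) (derivative p) hd
    have h1 := segmentIntegral_derivative (derivative^[k] ((X ^ 2 - 1) ^ n) * p)
    rw [derivative_mul, segmentIntegral_add, h0, add_zero, ← Function.iterate_succ_apply' derivative,
      eval_mul, eval_mul] at h1
    rw [h1]
    have e1 : (derivative^[k] (((X : ℝ[X]) ^ 2 - 1) ^ n)).eval 1 = 0 := by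
      rw [X_sq_sub_one_pow]
      exact eval_iterate_derivative_X_sub_C_pow_mul_of_lt (by omega) 1 _
    have e2 : (derivative^[k] (((X : ℝ[X]) ^ 2 - 1) ^ n)).eval (-1) = 0 := by
      rw [X_sq_sub_one_pow_eq_at_neg_one]
      exact eval_iterate_derivative_X_sub_C_pow_mul_of_lt (by omega) (-1) _
    rw [e1, e2]
    simp

lemma segmentIntegral_legendreP_mul {n : ℕ} {p : ℝ[X]} (hp : p.degree < n) :
    segmentIntegral (legendreP n * p) = 0 := by
  rw [legendreP, mul_assoc, segmentIntegral_C_mul,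
    segmentIntegral_iterate_derivative_mul le_rfl p hp, mul_zero]

/-- Otherwise `P_n` would have degree below `n` and be orthogonal to itself, hence zero, against
`P_n(1) = 1`. -/
lemma coeff_legendreP_ne_zero (n : ℕ) : (legendreP n).coeff n ≠ 0 := by
  intro h
  have hd : (legendreP n).degree < n := by
    rw [degree_lt_iff_coeff_zero]
    intro m hm
    rcases hm.eq_or_lt with rfl | hm
    · exact h
    · exact coeff_eq_zero_of_natDegree_lt ((natDegree_legendreP_le n).trans_lt hm)
  have h0 := eq_zero_of_segmentIntegral_mul_self (segmentIntegral_legendreP_mul hd)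
  simpa [h0] using legendreP_eval_one n

/-- With `p = P_n`, the leading terms of `X p'` and `n p` cancel, so their difference is orthogonal
to `p`. Integrating `(X p²)' = p² + 2 p X p'` then gives `(2n + 1) ∫ p² = p(1)² + p(-1)² = 2`. -/
lemma segmentIntegral_legendreP_mul_self (n : ℕ) :
    segmentIntegral (legendreP n * legendreP n) = 2 / (2 * n + 1) := by
  set p := legendreP n with hp
  have hlow : (X * derivative p - C (n : ℝ) * p).degree < (n : WithBot ℕ) := by
    rw [degree_lt_iff_coeff_zero]
    intro m hm
    rw [coeff_sub, coeff_C_mul]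
    have hX : (X * derivative p).coeff m = m * p.coeff m := by
      cases m with
      | zero => simp
      | succ m => rw [coeff_X_mul, coeff_derivative]; push_cast; ring
    rw [hX]
    rcases hm.eq_or_lt with rfl | hm
    · ring
    · rw [coeff_eq_zero_of_natDegree_lt ((natDegree_legendreP_le n).trans_lt hm)]
      ring
  have h1 := segmentIntegral_legendreP_mul hlow
  have h2 := segmentIntegral_derivative (X * (p * p))
  have h3 : derivative (X * (p * p)) =
      C (2 * (n : ℝ) + 1) * (p * p) + C 2 * (p * (X * derivative p - C (n : ℝ) * p)) := by
    simp only [derivative_mul, derivative_X, map_add, map_mul, map_one, map_natCast]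
    rw [show (C 2 : ℝ[X]) = 2 from rfl]
    ring
  rw [h3, segmentIntegral_add, segmentIntegral_C_mul, segmentIntegral_C_mul, h1] at h2
  have h4 := legendreP_eval_one n
  have h5 := legendreP_eval_neg_one_sq n
  rw [← hp] at h4 h5
  simp only [eval_mul, eval_X, h4] at h2
  have : (2 * (n : ℝ) + 1) ≠ 0 := by positivity
  field_simp
  linarith

/-- A polynomial of degree at most `n` orthogonal to all polynomials of smaller degree is a
multiple of the Legendre polynomial. -/
lemma exists_eq_C_mul_legendreP {n : ℕ} {q : ℝ[X]} (hq : q.natDegree ≤ n)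
    (h : ∀ p : ℝ[X], p.degree < n → segmentIntegral (q * p) = 0) :
    ∃ a : ℝ, q = C a * legendreP n := by
  refine ⟨q.coeff n / (legendreP n).coeff n, ?_⟩
  set a := q.coeff n / (legendreP n).coeff n with ha
  rw [← sub_eq_zero]
  have hd : (q - C a * legendreP n).degree < n := by
    rw [degree_lt_iff_coeff_zero]
    intro m hm
    rw [coeff_sub, coeff_C_mul]
    rcases hm.eq_or_lt with rfl | hm
    · rw [ha, div_mul_cancel₀ _ (coeff_legendreP_ne_zero n), sub_self]
    · rw [coeff_eq_zero_of_natDegree_lt ((natDegree_legendreP_le n).trans_lt hm),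
        coeff_eq_zero_of_natDegree_lt (hq.trans_lt hm)]
      ring
  apply eq_zero_of_segmentIntegral_mul_self
  have e : (q - C a * legendreP n) * (q - C a * legendreP n) =
      q * (q - C a * legendreP n) + C (-a) * (legendreP n * (q - C a * legendreP n)) := by
    rw [C_neg]; ring
  rw [e, segmentIntegral_add, segmentIntegral_C_mul, h _ hd, segmentIntegral_legendreP_mul hd]
  simp

end Legendre

/-! ### Isometries acting on the sphere -/

section Isometries

open scoped RealInnerProductSpace

lemma dot_comm (x y : S2) : dot x y = dot y x := real_inner_comm _ _

lemma dot_self (x : S2) : dot x x = 1 := by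
  rw [dot, real_inner_self_eq_norm_sq, norm_eq_of_mem_sphere x, one_pow]

lemma dot_rotate (ρ : E3 ≃ₗᵢ[ℝ] E3) (x y : S2) : dot (rotate ρ x) (rotate ρ y) = dot x y :=
  ρ.inner_map_map _ _

lemma abs_dot_le_one (x y : S2) : |dot x y| ≤ 1 := by
  simpa [dot, norm_eq_of_mem_sphere] using abs_real_inner_le_norm (x : E3) (y : E3)

lemma continuous_dot_left (y : S2) : Continuous fun x : S2 => dot x y := by
  unfold dot; fun_prop

lemma continuous_dot : Continuous fun q : S2 × S2 => dot q.1 q.2 := by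
  unfold dot; fun_prop

lemma continuous_rotate (ρ : E3 ≃ₗᵢ[ℝ] E3) : Continuous (rotate ρ) :=
  (ρ.continuous.comp continuous_subtype_val).subtype_mk _

/-- The action of a linear isometry on the sphere, as a measurable equivalence. -/
noncomputable def rotateEquiv (ρ : E3 ≃ₗᵢ[ℝ] E3) : S2 ≃ᵐ S2 where
  toFun := rotate ρ
  invFun := rotate ρ.symm
  left_inv x := Subtype.ext (ρ.symm_apply_apply x)
  right_inv x := Subtype.ext (ρ.apply_symm_apply x)
  measurable_toFun := (continuous_rotate ρ).measurable
  measurable_invFun := (continuous_rotate ρ.symm).measurable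

instance : IsFiniteMeasure sphereMeasure := inferInstanceAs (IsFiniteMeasure (Measure.toSphere _))

open scoped Pointwise in
lemma measurePreserving_rotateEquiv (ρ : E3 ≃ₗᵢ[ℝ] E3) :
    MeasurePreserving (rotateEquiv ρ) sphereMeasure sphereMeasure := by
  refine ⟨(rotateEquiv ρ).measurable, ?_⟩
  ext s hs
  rw [Measure.map_apply (rotateEquiv ρ).measurable hs, sphereMeasure,
    -- The measure of `s` is a constant times the volume of the cone `(0, 1) • s`, and taking this
    -- cone commutes with `ρ`.
    Measure.toSphere_apply' _ hs, Measure.toSphere_apply' _ ((rotateEquiv ρ).measurable hs)]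
  congr 1
  rw [← ρ.measurePreserving.measure_preimage_emb ρ.toHomeomorph.measurableEmbedding
    (Set.Ioo (0 : ℝ) 1 • (Subtype.val '' s))]
  congr 1
  ext v
  simp only [Set.mem_smul, Set.mem_image, Set.mem_preimage]
  constructor
  · rintro ⟨r, hr, _, ⟨x, hx, rfl⟩, rfl⟩
    exact ⟨r, hr, _, ⟨rotate ρ x, hx, rfl⟩, (map_smul ρ r (x : E3)).symm⟩
  · rintro ⟨r, hr, _, ⟨x, hx, rfl⟩, hv⟩
    refine ⟨r, hr, _, ⟨rotate ρ.symm x, ?_, rfl⟩, ?_⟩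
    · rwa [show rotateEquiv ρ (rotate ρ.symm x) = x from (rotateEquiv ρ).apply_symm_apply x]
    · apply ρ.injective
      rw [map_smul, ← hv]
      exact congrArg (r • ·) (ρ.apply_symm_apply (x : E3))

lemma integral_comp_rotate (ρ : E3 ≃ₗᵢ[ℝ] E3) (f : S2 → ℝ) :
    ∫ x, f (rotate ρ x) ∂sphereMeasure = ∫ x, f x ∂sphereMeasure :=
  (measurePreserving_rotateEquiv ρ).integral_comp' f

lemma sphereMeasure_real_univ : sphereMeasure.real Set.univ = 4 * Real.pi := by
  rw [sphereMeasure, Measure.toSphere_real_apply_univ, measureReal_def,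
    EuclideanSpace.volume_ball_fin_three]
  rw [finrank_euclideanSpace_fin]
  rw [ENNReal.ofReal_one, one_pow, one_mul, ENNReal.toReal_ofReal (by positivity)]
  push_cast
  ring

/-- Pairs of points of the sphere with the same dot product are congruent. -/
lemma exists_rotate_eq {x y x' y' : S2} (h : dot x y = dot x' y') :
    ∃ ρ : E3 ≃ₗᵢ[ℝ] E3, rotate ρ x = x' ∧ rotate ρ y = y' := by
  set ρ₁ := (ℝ ∙ ((x : E3) - x'))ᗮ.reflection
  have h1 : ρ₁ x = x' := Submodule.reflection_sub (by simp)
  -- The second reflection does not undo the first: equality of the dot products says that `x'` is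
  -- orthogonal to `ρ₁ y - y'`.
  set ρ₂ := (ℝ ∙ (ρ₁ y - y'))ᗮ.reflection
  have h2 : ρ₂ (ρ₁ y) = y' := Submodule.reflection_sub (by simp)
  have h3 : ρ₂ x' = x' := by
    refine Submodule.reflection_mem_subspace_eq_self ?_
    rw [Submodule.mem_orthogonal_singleton_iff_inner_right, inner_sub_left, sub_eq_zero,
      real_inner_comm, real_inner_comm (x' : E3)]
    calc ⟪(x' : E3), ρ₁ y⟫ = ⟪ρ₁ x, ρ₁ y⟫ := by rw [h1]
      _ = ⟪(x : E3), y⟫ := ρ₁.inner_map_map _ _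
      _ = ⟪(x' : E3), y'⟫ := h
  refine ⟨ρ₁.trans ρ₂, Subtype.ext ?_, Subtype.ext ?_⟩
  · change ρ₂ (ρ₁ x) = x'
    rw [h1, h3]
  · exact h2

/-- Invariance of a kernel under rotations implies invariance under all linear isometries, since
two points of the sphere of `ℝ³` are fixed by some plane reflection. -/
lemma apply_rotate_of_det_eq_one {K : S2 → S2 → ℝ}
    (hK : ∀ ρ : E3 ≃ₗᵢ[ℝ] E3, LinearMap.det (ρ.toLinearEquiv : E3 →ₗ[ℝ] E3) = 1 →
      ∀ x y, K (rotate ρ x) (rotate ρ y) = K x y) (ρ : E3 ≃ₗᵢ[ℝ] E3) (x y : S2) :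
    K (rotate ρ x) (rotate ρ y) = K x y := by
  have hdet : LinearMap.det (ρ.toLinearEquiv : E3 →ₗ[ℝ] E3) = 1 ∨
      LinearMap.det (ρ.toLinearEquiv : E3 →ₗ[ℝ] E3) = -1 := by
    have h := ρ.toLinearIsometry.normDet_eq_one
    rw [LinearMap.normDet_eq_abs_det] at h
    exact (abs_eq zero_le_one).mp h
  rcases hdet with hd | hd
  · exact hK ρ hd x y
  obtain ⟨v, hv, hv0⟩ : ∃ v ∈ (Submodule.span ℝ {(x : E3), (y : E3)})ᗮ, v ≠ 0 := by
    apply Submodule.exists_mem_ne_zero_of_ne_bot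
    intro hbot
    have h1 := Submodule.finrank_add_finrank_orthogonal (Submodule.span ℝ {(x : E3), (y : E3)})
    rw [hbot, finrank_bot, finrank_euclideanSpace_fin] at h1
    have h2 : Module.finrank ℝ (Submodule.span ℝ {(x : E3), (y : E3)}) ≤ 2 :=
      (finrank_span_le_card _).trans (by
        rw [Set.toFinset_insert, Set.toFinset_singleton]
        exact Finset.card_le_two)
    omega
  set σ := (ℝ ∙ v)ᗮ.reflection with hσ
  have hfix : ∀ z : S2, (z : E3) ∈ Submodule.span ℝ {(x : E3), (y : E3)} → rotate σ z = z := by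
    intro z hz
    refine Subtype.ext (Submodule.reflection_mem_subspace_eq_self ?_)
    rw [Submodule.mem_orthogonal_singleton_iff_inner_left]
    exact hv z hz
  have hσd : LinearMap.det (σ.toLinearEquiv : E3 →ₗ[ℝ] E3) = -1 := by
    have := (ℝ ∙ v)ᗮ.det_reflection
    rw [Submodule.orthogonal_orthogonal, finrank_span_singleton hv0, pow_one] at this
    exact this
  have := hK (σ.trans ρ) (by
    have : ((σ.trans ρ).toLinearEquiv : E3 →ₗ[ℝ] E3) =
      (ρ.toLinearEquiv : E3 →ₗ[ℝ] E3) ∘ₗ (σ.toLinearEquiv : E3 →ₗ[ℝ] E3) := rfl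
    rw [this, LinearMap.det_comp, hd, hσd]; norm_num) x y
  have hr : ∀ z, rotate (σ.trans ρ) z = rotate ρ (rotate σ z) := fun z => rfl
  rwa [hr, hr, hfix x (Submodule.subset_span (by simp)),
    hfix y (Submodule.subset_span (by simp))] at this

end Isometries

/-! ### Integrals of zonal polynomials and Archimedes' formula -/

section ZonalIntegrals

open Polynomial

/-- The `i`-th coordinate vector, as a point of the sphere. -/
noncomputable def axis (i : Fin 3) : S2 := ⟨EuclideanSpace.single i 1, by simp⟩

lemma dot_axis (x : S2) (i : Fin 3) : dot x (axis i) = (x : E3) i := by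
  simp [dot, axis, EuclideanSpace.inner_single_right]

lemma integrable_of_continuous {f : S2 → ℝ} (hf : Continuous f) : Integrable f sphereMeasure :=
  hf.integrable_of_hasCompactSupport (HasCompactSupport.of_compactSpace f)

/-- The integral against an invariant kernel of a function of the dot products with two points
depends only on the dot product of these points. -/
lemma integral_dot_eq {y c y' c' : S2} (h : dot y c = dot y' c') {K : S2 → S2 → ℝ}
    (hK : ∀ ρ x y, K (rotate ρ x) (rotate ρ y) = K x y) (f : ℝ → ℝ → ℝ) :
    ∫ x, K x y * f (dot x y) (dot x c) ∂sphereMeasure =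
      ∫ x, K x y' * f (dot x y') (dot x c') ∂sphereMeasure := by
  obtain ⟨ρ, rfl, rfl⟩ := exists_rotate_eq h
  rw [← integral_comp_rotate ρ fun x =>
    K x (rotate ρ y) * f (dot x (rotate ρ y)) (dot x (rotate ρ c))]
  simp only [hK, dot_rotate]

lemma dot_neg_right (x y : S2) : dot x (-y) = -dot x y := by simp [dot]

/-- Since `u ⟂ y`, the pairs `(y, u)` and `(y, -u)` are congruent, so the integral equals its own
negative. -/
lemma integral_dot_pow_odd {y u : S2} (h : dot y u = 0) {K : S2 → S2 → ℝ}
    (hK : ∀ ρ x y, K (rotate ρ x) (rotate ρ y) = K x y) (k : ℕ) {m : ℕ} (hm : Odd m) :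
    ∫ x, K x y * (dot x y ^ k * dot x u ^ m) ∂sphereMeasure = 0 := by
  have h1 := integral_dot_eq (y := y) (c := u) (y' := y) (c' := -u)
    (by rw [dot_neg_right, h, neg_zero]) hK fun s t => s ^ k * t ^ m
  simp only [dot_neg_right, hm.neg_pow, mul_neg, integral_neg] at h1
  linarith

/-- The point of the sphere at colatitude `arccos t` from the first axis towards the second. -/
noncomputable def meridian (t : ℝ) (ht : |t| ≤ 1) : S2 :=
  ⟨t • (axis 0 : E3) + √(1 - t ^ 2) • (axis 1 : E3), by
    have h : 0 ≤ 1 - t ^ 2 := by nlinarith [abs_le.mp ht]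
    rw [mem_sphere_zero_iff_norm, EuclideanSpace.norm_eq, Real.sqrt_eq_one]
    simp [Fin.sum_univ_three, axis, Real.sq_sqrt h]⟩

lemma dot_meridian (x : S2) (t : ℝ) (ht : |t| ≤ 1) :
    dot x (meridian t ht) = t * dot x (axis 0) + √(1 - t ^ 2) * dot x (axis 1) := by
  simp [dot, meridian, inner_add_right, inner_smul_right]

lemma dot_axis_zero_one : dot (axis 0) (axis 1) = 0 := by
  rw [dot_axis]
  simp [axis]

/-- Move `y` to the first axis and `c` to the meridian point with `t = y · c`, and expand `(x · c) ^
n` by the binomial theorem. Odd powers of `√(1 - t²)` come with odd moments, which vanish; the rest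
is polynomial in `t`. -/
lemma exists_integral_kernel_mul_dot_pow {K : S2 → S2 → ℝ}
    (hK : ∀ ρ x y, K (rotate ρ x) (rotate ρ y) = K x y)
    (hc : ∀ y, Continuous fun x => K x y) (n : ℕ) :
    ∃ q : ℝ[X], q.natDegree ≤ n ∧ ∀ y c,
      ∫ x, K x y * dot x c ^ n ∂sphereMeasure = q.eval (dot y c) := by
  let A : ℕ → ℝ := fun k =>
    ∫ x, K x (axis 0) * (dot x (axis 0) ^ k * dot x (axis 1) ^ (n - k)) ∂sphereMeasure
  refine ⟨∑ k ∈ Finset.range (n + 1), if Even (n - k) then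
    C (A k * n.choose k) * (X ^ k * (1 - X ^ 2) ^ ((n - k) / 2)) else 0, ?_, fun y c => ?_⟩
  · refine natDegree_sum_le_of_forall_le _ _ fun k hk => ?_
    rw [Finset.mem_range] at hk
    split_ifs
    · have h1 : (1 - X ^ 2 : ℝ[X]).natDegree ≤ 2 :=
        (natDegree_sub_le _ _).trans (by simp)
      refine (natDegree_C_mul_le _ _).trans (natDegree_mul_le.trans ?_)
      have h2 : ((1 - X ^ 2 : ℝ[X]) ^ ((n - k) / 2)).natDegree ≤ (n - k) / 2 * 2 :=
        natDegree_pow_le_of_le _ h1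
      have h3 : (X ^ k : ℝ[X]).natDegree = k := natDegree_X_pow k
      omega
    · simp
  · have ht := abs_dot_le_one y c
    have h0 : dot y c = dot (axis 0) (meridian (dot y c) ht) := by
      rw [dot_meridian, dot_axis_zero_one, dot_self]; ring
    rw [integral_dot_eq h0 hK fun _ t => t ^ n]
    simp only [dot_meridian, add_pow, Finset.mul_sum]
    rw [integral_finsetSum _ fun k _ => integrable_of_continuous ?_]
    · rw [eval_finsetSum]
      refine Finset.sum_congr rfl fun k hk => ?_
      set t := dot y c
      have e : ∀ x, K x (axis 0) * ((t * dot x (axis 0)) ^ k *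
          (√(1 - t ^ 2) * dot x (axis 1)) ^ (n - k) * (n.choose k : ℝ)) =
          (t ^ k * √(1 - t ^ 2) ^ (n - k) * n.choose k) *
            (K x (axis 0) * (dot x (axis 0) ^ k * dot x (axis 1) ^ (n - k))) := fun x => by ring
      simp only [e]
      rw [integral_const_mul]
      split_ifs with hev
      · have hs : √(1 - t ^ 2) ^ (n - k) = (1 - t ^ 2) ^ ((n - k) / 2) := by
          conv_lhs => rw [← Nat.two_mul_div_two_of_even hev, pow_mul]
          rw [Real.sq_sqrt (by nlinarith [abs_le.mp ht])]
        rw [hs]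
        simp only [eval_mul, eval_C, eval_pow, eval_X, eval_sub, eval_one]
        change _ * A k = _
        ring
      · rw [integral_dot_pow_odd dot_axis_zero_one hK k (Nat.not_even_iff_odd.mp hev)]
        simp
    · have h1 := continuous_dot_left (axis 0)
      have h2 := continuous_dot_left (axis 1)
      have h3 := hc (axis 0)
      fun_prop

/-- Integration against a rotation invariant kernel maps zonal polynomials to zonal polynomials,
without raising the degree. -/
lemma exists_integral_kernel_mul_eval {K : S2 → S2 → ℝ}
    (hK : ∀ ρ x y, K (rotate ρ x) (rotate ρ y) = K x y)
    (hc : ∀ y, Continuous fun x => K x y) {n : ℕ} {h : ℝ[X]} (hn : h.natDegree ≤ n) :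
    ∃ q : ℝ[X], q.natDegree ≤ n ∧ ∀ y c,
      ∫ x, K x y * h.eval (dot x c) ∂sphereMeasure = q.eval (dot y c) := by
  choose Q hQd hQ using exists_integral_kernel_mul_dot_pow hK hc
  refine ⟨∑ k ∈ Finset.range (n + 1), C (h.coeff k) * Q k, ?_, fun y c => ?_⟩
  · refine natDegree_sum_le_of_forall_le _ _ fun k hk => ?_
    rw [Finset.mem_range] at hk
    exact (natDegree_C_mul_le _ _).trans ((hQd k).trans (by omega))
  · simp only [eval_eq_sum_range' (Nat.lt_succ_of_le hn), Finset.mul_sum]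
    rw [integral_finsetSum _ fun k _ => integrable_of_continuous ?_]
    · rw [eval_finsetSum]
      refine Finset.sum_congr rfl fun k _ => ?_
      rw [eval_mul, eval_C, ← hQ k y c, ← integral_const_mul]
      congr 1 with x
      ring
    · have h2 := continuous_dot_left c
      have h3 := hc y
      fun_prop

lemma integral_fun_dot_eq (f : ℝ → ℝ) (c c' : S2) :
    ∫ x, f (dot x c) ∂sphereMeasure = ∫ x, f (dot x c') ∂sphereMeasure := by
  simpa using integral_dot_eq (y := c) (c := c) (y' := c') (c' := c')
    (by rw [dot_self, dot_self]) (K := fun _ _ => 1) (fun _ _ _ => rfl) fun s _ => f s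

/-- The vector `e₀ + b e₁` has length `√(1 + b²)`, so by rotation invariance the moment of order `2n
+ 2` in its direction is `(1 + b²) ^ (n + 1) M`. Comparing coefficients of `b²` gives the identity.
-/
lemma integral_dot_axis_pow_two_mul_sq (n : ℕ) :
    (2 * (n : ℝ) + 1) * ∫ x, dot x (axis 0) ^ (2 * n) * dot x (axis 1) ^ 2 ∂sphereMeasure =
      ∫ x, dot x (axis 0) ^ (2 * n + 2) ∂sphereMeasure := by
  have h1 := continuous_dot_left (axis 0)
  have h2 := continuous_dot_left (axis 1)
  set M := ∫ x, dot x (axis 0) ^ (2 * n + 2) ∂sphereMeasure with hM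
  let A : ℕ → ℝ := fun k =>
    ∫ x, dot x (axis 1) ^ k * dot x (axis 0) ^ (2 * n + 2 - k) ∂sphereMeasure
  have hpoly : ∑ k ∈ Finset.range (2 * n + 2 + 1), C (((2 * n + 2).choose k : ℝ) * A k) * X ^ k =
      C M * expand ℝ 2 ((1 + X) ^ (n + 1)) := by
    refine Polynomial.funext fun b => ?_
    have hpos : 0 < 1 + b ^ 2 := by positivity
    let c : S2 := ⟨(√(1 + b ^ 2))⁻¹ • ((axis 0 : E3) + b • (axis 1 : E3)), by
      rw [mem_sphere_zero_iff_norm, norm_smul, EuclideanSpace.norm_eq]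
      simp only [Fin.sum_univ_three, axis]
      simp [abs_of_nonneg, (Real.sqrt_pos.mpr hpos).ne']⟩
    have hcd : ∀ x, dot x (axis 0) + b * dot x (axis 1) = √(1 + b ^ 2) * dot x c := by
      intro x
      have := (Real.sqrt_pos.mpr hpos).ne'
      simp only [dot, c, inner_add_right, inner_smul_right]
      field_simp
    have hI : ∫ x, (b * dot x (axis 1) + dot x (axis 0)) ^ (2 * n + 2) ∂sphereMeasure =
        (1 + b ^ 2) ^ (n + 1) * M := by
      simp only [add_comm (b * _), hcd, mul_pow]
      rw [integral_const_mul, integral_fun_dot_eq (fun t => t ^ (2 * n + 2)) c (axis 0), ← hM,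
        show 2 * n + 2 = 2 * (n + 1) by ring, pow_mul, Real.sq_sqrt hpos.le]
    simp only [add_pow _ _ (2 * n + 2)] at hI
    rw [integral_finsetSum _ fun k _ => integrable_of_continuous (by fun_prop)] at hI
    rw [eval_finsetSum, eval_mul, eval_C, expand_eval, eval_pow, eval_add, eval_one, eval_X]
    rw [mul_comm M, ← hI]
    refine Finset.sum_congr rfl fun k _ => ?_
    rw [eval_mul, eval_C, eval_pow, eval_X, mul_comm _ (b ^ k), ← mul_assoc, ← integral_const_mul]
    congr 1 with x
    ring
  have hco := congrArg (fun p => coeff p 2) hpoly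
  simp only [finsetSum_coeff, coeff_C_mul, coeff_X_pow] at hco
  rw [Finset.sum_eq_single 2 (fun k _ hk => by simp [hk.symm]) (by simp),
    show coeff (expand ℝ 2 ((1 + X) ^ (n + 1))) 2 = (n : ℝ) + 1 by
      have := coeff_expand_mul (p := 2) (by norm_num) ((1 + X : ℝ[X]) ^ (n + 1)) 1
      rw [one_mul, coeff_one_add_X_pow, Nat.choose_one_right] at this
      rw [this]; push_cast; ring, Nat.cast_choose_two] at hco
  have hA : A 2 = ∫ x, dot x (axis 0) ^ (2 * n) * dot x (axis 1) ^ 2 ∂sphereMeasure := by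
    simp only [A, Nat.add_sub_cancel, mul_comm]
  rw [hA] at hco
  push_cast at hco
  have : (n : ℝ) + 1 ≠ 0 := by positivity
  apply mul_left_cancel₀ this
  linarith

/-- Inserting `x₀² + x₁² + x₂² = 1` into the moment `M_n` of order `2n` gives `M_n = M_{n+1} (1 + 2
/ (2n + 1))`. -/
lemma integral_dot_pow_two_mul (n : ℕ) (c : S2) :
    ∫ x, dot x c ^ (2 * n) ∂sphereMeasure = 4 * Real.pi / (2 * n + 1) := by
  rw [integral_fun_dot_eq (fun t => t ^ (2 * n)) c (axis 0)]
  induction n with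
  | zero => simp [sphereMeasure_real_univ]
  | succ n ih =>
    have h0 := continuous_dot_left (axis 0)
    have h1 := continuous_dot_left (axis 1)
    have h2 := continuous_dot_left (axis 2)
    have hA := integral_dot_axis_pow_two_mul_sq n
    have hsymm : ∫ x, dot x (axis 0) ^ (2 * n) * dot x (axis 2) ^ 2 ∂sphereMeasure =
        ∫ x, dot x (axis 0) ^ (2 * n) * dot x (axis 1) ^ 2 ∂sphereMeasure := by
      simpa using integral_dot_eq (y := axis 0) (c := axis 2) (y' := axis 0) (c' := axis 1)
        (by rw [dot_axis_zero_one, dot_axis]; simp [axis]) (K := fun _ _ => 1)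
        (fun _ _ _ => rfl) fun s t => s ^ (2 * n) * t ^ 2
    have hsum : ∀ x : S2, dot x (axis 0) ^ (2 * n) = dot x (axis 0) ^ (2 * n + 2) +
        dot x (axis 0) ^ (2 * n) * dot x (axis 1) ^ 2 +
        dot x (axis 0) ^ (2 * n) * dot x (axis 2) ^ 2 := by
      intro x
      have hx : dot x (axis 0) ^ 2 + dot x (axis 1) ^ 2 + dot x (axis 2) ^ 2 = 1 := by
        have := EuclideanSpace.real_norm_sq_eq (x : E3)
        rw [norm_eq_of_mem_sphere, Fin.sum_univ_three] at this
        simp only [dot_axis]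
        linarith
      calc dot x (axis 0) ^ (2 * n) = dot x (axis 0) ^ (2 * n) * 1 := (mul_one _).symm
        _ = _ := by rw [← hx]; ring
    have ih' := (integral_congr_ae (.of_forall hsum)).symm.trans ih
    rw [integral_add (integrable_of_continuous (by fun_prop))
      (integrable_of_continuous (by fun_prop)), integral_add (integrable_of_continuous
      (by fun_prop)) (integrable_of_continuous (by fun_prop)), hsymm, ← hA] at ih'
    rw [mul_add, mul_one, ← hA]
    have e1 : (2 * (n : ℝ) + 1) ≠ 0 := by positivity
    have e2 : (2 * ((n + 1 : ℕ) : ℝ) + 1) ≠ 0 := by positivity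
    rw [eq_div_iff e1] at ih'
    rw [eq_div_iff e2]
    push_cast
    linarith

/-- Archimedes' formula: the projection of the surface measure of the sphere to a diameter is
uniform. -/
lemma integral_eval_dot (p : ℝ[X]) (c : S2) :
    ∫ x, p.eval (dot x c) ∂sphereMeasure = 2 * Real.pi * segmentIntegral p := by
  have hd := continuous_dot_left c
  induction p using Polynomial.induction_on' with
  | add p q hp hq =>
    simp only [eval_add]
    rw [integral_add (integrable_of_continuous (by fun_prop))
      (integrable_of_continuous (by fun_prop)), hp, hq, segmentIntegral_add]
    ring
  | monomial n a =>
    simp only [eval_monomial, segmentIntegral]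
    rw [integral_const_mul, intervalIntegral.integral_const_mul, integral_pow]
    rcases Nat.even_or_odd' n with ⟨m, rfl | rfl⟩
    · rw [integral_dot_pow_two_mul, Odd.neg_one_pow ⟨m, rfl⟩]
      push_cast
      ring
    · have h' := integral_fun_dot_eq (fun t => t ^ (2 * m + 1)) c (-c)
      simp only [dot_neg_right, Odd.neg_pow ⟨m, rfl⟩, integral_neg] at h'
      rw [show ∫ x, dot x c ^ (2 * m + 1) ∂sphereMeasure = 0 by linarith,
        Even.neg_one_pow ⟨m + 1, by ring⟩]
      simp

end ZonalIntegrals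

/-! ### The Funk–Hecke formula and the reproducing property -/

section FunkHecke

open Polynomial

lemma integral_integral_swap_of_continuous {f : S2 → S2 → ℝ}
    (hf : Continuous fun q : S2 × S2 => f q.1 q.2) :
    ∫ x, ∫ y, f x y ∂sphereMeasure ∂sphereMeasure =
      ∫ y, ∫ x, f x y ∂sphereMeasure ∂sphereMeasure :=
  integral_integral_swap
    (hf.integrable_of_hasCompactSupport (HasCompactSupport.of_compactSpace _))

/-- The Funk–Hecke formula: zonal Legendre polynomials are eigenfunctions of the integral operators
with rotation invariant kernels. -/
lemma exists_integral_kernel_mul_legendreP {K : S2 → S2 → ℝ}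
    (hK : ∀ ρ x y, K (rotate ρ x) (rotate ρ y) = K x y) (hs : ∀ x y, K x y = K y x)
    (hc : Continuous fun q : S2 × S2 => K q.1 q.2) (n : ℕ) :
    ∃ a : ℝ, ∀ y c, ∫ x, K x y * (legendreP n).eval (dot x c) ∂sphereMeasure =
      a * (legendreP n).eval (dot y c) := by
  have hc' : ∀ y, Continuous fun x => K x y := fun y =>
    hc.comp (Continuous.prodMk continuous_id continuous_const)
  obtain ⟨q, hqd, hq⟩ := exists_integral_kernel_mul_eval hK hc' (natDegree_legendreP_le n)
  suffices h : ∃ a : ℝ, q = C a * legendreP n by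
    obtain ⟨a, rfl⟩ := h
    exact ⟨a, fun y c => by rw [hq, eval_mul, eval_C]⟩
  refine exists_eq_C_mul_legendreP hqd fun p hp => ?_
  rcases Nat.eq_zero_or_pos n with rfl | hn
  · have : p = 0 := by simpa using hp
    simp [this, segmentIntegral]
  have hpd : p.natDegree ≤ n - 1 := by
    rw [natDegree_le_iff_coeff_eq_zero]
    intro m hm
    exact (degree_lt_iff_coeff_zero _ _).mp hp m (by omega)
  obtain ⟨r, hrd, hr⟩ := exists_integral_kernel_mul_eval hK hc' hpd
  let c := axis 0
  have hd := continuous_dot_left c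
  have h0 : ∫ x, (legendreP n * r).eval (dot x c) ∂sphereMeasure = 0 := by
    rw [integral_eval_dot, segmentIntegral_legendreP_mul, mul_zero]
    exact degree_le_natDegree.trans_lt (by exact_mod_cast (by omega : r.natDegree < n))
  -- Self-adjointness: Fubini and the symmetry of `K` move the operator from `P_n` to `p`, whose
  -- image `r` still has degree below `n`.
  have h1 : ∫ y, (q * p).eval (dot y c) ∂sphereMeasure =
      ∫ x, (legendreP n * r).eval (dot x c) ∂sphereMeasure := by
    simp only [eval_mul, ← hq, ← hr, ← integral_const_mul, ← integral_mul_const]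
    rw [integral_integral_swap_of_continuous (f := fun y x =>
      K x y * (legendreP n).eval (dot x c) * p.eval (dot y c))]
    · congr 1 with x
      congr 1 with y
      rw [hs x y]
      ring
    · have h2 : Continuous fun q : S2 × S2 => K q.2 q.1 := hc.comp continuous_swap
      fun_prop
  rw [integral_eval_dot, h0] at h1
  exact (mul_eq_zero.mp h1).resolve_left (by positivity)

lemma segmentIntegral_legendreP_mul_of_ne {l m : ℕ} (h : l ≠ m) :
    segmentIntegral (legendreP l * legendreP m) = 0 := by
  wlog hlt : m < l generalizing l m
  · rw [mul_comm]
    exact this h.symm (by omega)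
  exact segmentIntegral_legendreP_mul (degree_le_natDegree.trans_lt
    (by exact_mod_cast (natDegree_legendreP_le m).trans_lt hlt))

/-- The reproducing property of the Legendre polynomials. -/
lemma integral_legendreP_mul_legendreP (l m : ℕ) (y c : S2) :
    ∫ x, (legendreP l).eval (dot x y) * (legendreP m).eval (dot x c) ∂sphereMeasure =
      if l = m then 4 * Real.pi / (2 * l + 1) * (legendreP l).eval (dot y c) else 0 := by
  obtain ⟨a, ha⟩ := exists_integral_kernel_mul_legendreP
    (K := fun x y => (legendreP l).eval (dot x y)) (fun ρ x y => by rw [dot_rotate])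
    (fun x y => by rw [dot_comm]) ((legendreP l).continuous.comp continuous_dot) m
  -- The eigenvalue is read off at `y = c`, where `P_m(1) = 1`.
  have h := ha c c
  simp only [← eval_mul] at h
  rw [integral_eval_dot, dot_self, legendreP_eval_one, mul_one] at h
  rw [ha y c, ← h]
  split_ifs with hlm
  · subst hlm
    rw [segmentIntegral_legendreP_mul_self]
    ring
  · rw [segmentIntegral_legendreP_mul_of_ne hlm]
    ring

end FunkHecke

/-! ### Second moments of integrals of the field -/

section RandomField

section Pairing

variable {Ω : Type*} {X : S2 → Ω → ℝ}

/-- The integral of the sample paths of a random field against a function on the sphere. -/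
noncomputable def pairing (X : S2 → Ω → ℝ) (f : S2 → ℝ) (ω : Ω) : ℝ :=
  ∫ x, X x ω * f x ∂sphereMeasure

lemma pairing_mul_pairing (f g : S2 → ℝ) (ω : Ω) :
    pairing X f ω * pairing X g ω =
      ∫ q : S2 × S2, (X q.1 ω * f q.1) * (X q.2 ω * g q.2)
        ∂(sphereMeasure.prod sphereMeasure) :=
  (integral_prod_mul (fun x => X x ω * f x) fun y => X y ω * g y).symm

end Pairing

variable {Ω : Type*} [MeasurableSpace Ω] {P : Measure Ω} {X : S2 → Ω → ℝ}

/-- The covariance function of a centered random field. -/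
noncomputable def covKernel (P : Measure Ω) (X : S2 → Ω → ℝ) (x y : S2) : ℝ :=
  ∫ ω, X x ω * X y ω ∂P

lemma covKernel_comm (x y : S2) : covKernel P X x y = covKernel P X y x := by
  simp only [covKernel, mul_comm]

lemma covKernel_rotate (hX : IsStationaryField P X) (ρ : E3 ≃ₗᵢ[ℝ] E3) (x y : S2) :
    covKernel P X (rotate ρ x) (rotate ρ y) = covKernel P X x y :=
  apply_rotate_of_det_eq_one hX.stationary ρ x y

/-- The kernel is the `L²(P)` inner product of `X x` and `X y`, and mean square continuity is
continuity of `x ↦ X x` into `L²(P)`. -/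
lemma continuous_covKernel (hX : IsStationaryField P X) :
    Continuous fun q : S2 × S2 => covKernel P X q.1 q.2 := by
  let Φ : S2 → Lp ℝ 2 P := fun x => (hX.memLp x).toLp
  have hinner : ∀ {f g : Ω → ℝ} (hf : MemLp f 2 P) (hg : MemLp g 2 P),
      inner ℝ hf.toLp hg.toLp = ∫ ω, f ω * g ω ∂P := by
    intro f g hf hg
    rw [L2.inner_def]
    refine integral_congr_ae ?_
    filter_upwards [hf.coeFn_toLp, hg.coeFn_toLp] with ω h1 h2
    rw [h1, h2]
    simp [mul_comm]
  have hΦ : Continuous Φ := by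
    rw [continuous_iff_continuousAt]
    intro x
    rw [ContinuousAt, tendsto_iff_norm_sub_tendsto_zero]
    have h := (hX.mean_square_continuous x).sqrt
    rw [Real.sqrt_zero] at h
    refine h.congr fun y => ?_
    rw [← Real.sqrt_sq (norm_nonneg (Φ y - Φ x)), ← real_inner_self_eq_norm_sq,
      ← MemLp.toLp_sub, hinner]
    simp only [Pi.sub_apply, sq]
  have : (fun q : S2 × S2 => covKernel P X q.1 q.2) = fun q => inner ℝ (Φ q.1) (Φ q.2) := by
    funext q
    exact (hinner _ _).symm
  rw [this]
  fun_prop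

lemma aestronglyMeasurable_mul (hX : IsStationaryField P X) {f : S2 → ℝ}
    (hf : Continuous f) :
    AEStronglyMeasurable (fun q : S2 × Ω => X q.1 q.2 * f q.1) (sphereMeasure.prod P) :=
  hX.aestronglyMeasurable.mul (hf.measurable.comp measurable_fst).aestronglyMeasurable

variable [IsProbabilityMeasure P]

/-- Licenses Fubini for the second moments. The bound `|X x X y| ≤ (X x)² + (X y)²` has expectation
`K(x, x) + K(y, y)`, continuous on a compact space. -/
lemma integrable_mul_mul (hX : IsStationaryField P X) {f g : S2 → ℝ} (hf : Continuous f)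
    (hg : Continuous g) :
    Integrable (fun q : (S2 × S2) × Ω => (X q.1.1 q.2 * f q.1.1) * (X q.1.2 q.2 * g q.1.2))
      ((sphereMeasure.prod sphereMeasure).prod P) := by
  have hm1 : AEStronglyMeasurable (fun q : (S2 × S2) × Ω => X q.1.1 q.2)
      ((sphereMeasure.prod sphereMeasure).prod P) :=
    hX.aestronglyMeasurable.comp_quasiMeasurePreserving
      (QuasiMeasurePreserving.prodMap Measure.quasiMeasurePreserving_fst
        (Measure.QuasiMeasurePreserving.id P))
  have hm2 : AEStronglyMeasurable (fun q : (S2 × S2) × Ω => X q.1.2 q.2)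
      ((sphereMeasure.prod sphereMeasure).prod P) :=
    hX.aestronglyMeasurable.comp_quasiMeasurePreserving
      (QuasiMeasurePreserving.prodMap Measure.quasiMeasurePreserving_snd
        (Measure.QuasiMeasurePreserving.id P))
  have hmf : AEStronglyMeasurable (fun q : (S2 × S2) × Ω => f q.1.1)
      ((sphereMeasure.prod sphereMeasure).prod P) :=
    (hf.measurable.comp (measurable_fst.comp measurable_fst)).aestronglyMeasurable
  have hmg : AEStronglyMeasurable (fun q : (S2 × S2) × Ω => g q.1.2)
      ((sphereMeasure.prod sphereMeasure).prod P) :=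
    (hg.measurable.comp (measurable_snd.comp measurable_fst)).aestronglyMeasurable
  have hm := (hm1.mul hmf).mul (hm2.mul hmg)
  have hint : ∀ x y, Integrable (fun ω => (X x ω * f x) * (X y ω * g y)) P := fun x y =>
    ((hX.memLp x).mul_const (f x)).integrable_mul ((hX.memLp y).mul_const (g y))
  refine (integrable_prod_iff hm).mpr ⟨.of_forall fun q => hint q.1 q.2, ?_⟩
  have hcont := continuous_covKernel hX
  have hdiag : Continuous fun x => covKernel P X x x :=
    hcont.comp (Continuous.prodMk continuous_id continuous_id)
  have hB : Continuous fun q : S2 × S2 =>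
      (covKernel P X q.1 q.1 + covKernel P X q.2 q.2) * |f q.1 * g q.2| := by fun_prop
  refine (hB.integrable_of_hasCompactSupport (HasCompactSupport.of_compactSpace _)).mono'
    hm.norm.integral_prod_right' (.of_forall fun q => ?_)
  have hsq : ∀ x, Integrable (fun ω => X x ω * X x ω) P := fun x =>
    (hX.memLp x).integrable_mul (hX.memLp x)
  rw [Real.norm_of_nonneg (integral_nonneg fun ω => norm_nonneg _), covKernel, covKernel,
    ← integral_add (hsq _) (hsq _), ← integral_mul_const]
  refine integral_mono (hint q.1 q.2).norm (((hsq _).add (hsq _)).mul_const _) fun ω => ?_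
  change |X q.1 ω * f q.1 * (X q.2 ω * g q.2)| ≤ _
  rw [show X q.1 ω * f q.1 * (X q.2 ω * g q.2) = X q.1 ω * X q.2 ω * (f q.1 * g q.2) by ring,
    abs_mul]
  refine mul_le_mul_of_nonneg_right ?_ (abs_nonneg _)
  rw [abs_le]
  constructor <;> nlinarith [sq_nonneg (X q.1 ω + X q.2 ω), sq_nonneg (X q.1 ω - X q.2 ω)]

lemma memLp_pairing (hX : IsStationaryField P X) {f : S2 → ℝ} (hf : Continuous f) :
    MemLp (pairing X f) 2 P := by
  have hm : AEStronglyMeasurable (pairing X f) P :=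
    (aestronglyMeasurable_mul hX hf).prod_swap.integral_prod_right'
  rw [memLp_two_iff_integrable_sq hm]
  simp only [sq, pairing_mul_pairing]
  exact (integrable_mul_mul hX hf hf).integral_prod_right

lemma integral_pairing_mul_pairing (hX : IsStationaryField P X) {f g : S2 → ℝ}
    (hf : Continuous f) (hg : Continuous g) :
    ∫ ω, pairing X f ω * pairing X g ω ∂P =
      ∫ y, (∫ x, covKernel P X x y * f x ∂sphereMeasure) * g y ∂sphereMeasure := by
  simp only [pairing_mul_pairing]
  have h := integrable_mul_mul hX hf hg
  rw [integral_integral_swap (f := fun ω (q : S2 × S2) => X q.1 ω * f q.1 * (X q.2 ω * g q.2))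
    h.swap]
  rw [integral_prod_symm _ h.integral_prod_left]
  congr 1 with y
  rw [← integral_mul_const]
  congr 1 with x
  rw [covKernel, mul_assoc, ← integral_mul_const]
  congr 1 with ω
  ring

lemma integral_pairing (hX : IsStationaryField P X) {f : S2 → ℝ} (hf : Continuous f) :
    ∫ ω, pairing X f ω ∂P = 0 := by
  have hm := aestronglyMeasurable_mul hX hf
  have hint : ∀ x, Integrable (fun ω => X x ω * f x) P := fun x =>
    ((hX.memLp x).integrable one_le_two).mul_const _
  have hcont := continuous_covKernel hX
  have hdiag : Continuous fun x => covKernel P X x x :=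
    hcont.comp (Continuous.prodMk continuous_id continuous_id)
  -- The dominating function for Fubini comes from `|X| ≤ 1 + X²`.
  have hB : Continuous fun x => (1 + covKernel P X x x) * |f x| := by fun_prop
  have h : Integrable (fun q : S2 × Ω => X q.1 q.2 * f q.1) (sphereMeasure.prod P) := by
    refine (integrable_prod_iff hm).mpr ⟨.of_forall hint, ?_⟩
    refine (integrable_of_continuous hB).mono' hm.norm.integral_prod_right'
      (.of_forall fun x => ?_)
    have hsq : Integrable (fun ω => X x ω * X x ω) P :=
      (hX.memLp x).integrable_mul (hX.memLp x)
    have h1 : (1 : ℝ) = ∫ _, 1 ∂P := by simp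
    rw [Real.norm_of_nonneg (integral_nonneg fun ω => norm_nonneg _), covKernel, h1,
      ← integral_add (integrable_const _) hsq, ← integral_mul_const]
    refine integral_mono (hint x).norm (((integrable_const _).add hsq).mul_const _) fun ω => ?_
    change |X x ω * f x| ≤ _
    rw [abs_mul]
    refine mul_le_mul_of_nonneg_right ?_ (abs_nonneg _)
    rw [abs_le]
    constructor <;> nlinarith [sq_nonneg (X x ω + 1), sq_nonneg (X x ω - 1)]
  simp only [pairing]
  rw [integral_integral_swap (f := fun ω x => X x ω * f x) h.swap]
  simp [integral_mul_const, hX.mean_zero]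

end RandomField

/-! ### Power spectrum and covariance of needlet coefficients -/

section NeedletCoefficients

open Polynomial

lemma continuous_eval_dot (p : ℝ[X]) (c : S2) : Continuous fun x => p.eval (dot x c) :=
  p.continuous.comp (continuous_dot_left c)

lemma eval_legendreL (l : ℕ) (t : ℝ) :
    (legendreL l).eval t = (2 * (l : ℝ) + 1) / (4 * Real.pi) * (legendreP l).eval t := by
  rw [legendreL, eval_mul, eval_C]

/-- The normalization of `L_ℓ` exactly absorbs the factor `4π / (2ℓ + 1)` of the reproducing formula
for `P_ℓ`. -/
lemma integral_legendreL_mul_legendreL (l m : ℕ) (c c' : S2) :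
    ∫ x, (legendreL l).eval (dot x c) * (legendreL m).eval (dot x c') ∂sphereMeasure =
      if l = m then (legendreL l).eval (dot c c') else 0 := by
  simp only [eval_legendreL, mul_mul_mul_comm, integral_const_mul,
    integral_legendreP_mul_legendreP]
  split_ifs with h
  · subst h
    have : (2 * (l : ℝ) + 1) ≠ 0 := by positivity
    field_simp
  · simp

/-- The harmonic `Y_{ℓ,0}` is real and zonal about the third axis, which ties `C_ℓ` to zonal
pairings. -/
lemma harmonicCoeff_zero {Ω : Type*} (X : S2 → Ω → ℝ) (l : ℕ) (ω : Ω) :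
    harmonicCoeff X l 0 ω = ((√((2 * (l : ℝ) + 1) / (4 * Real.pi)) *
      pairing X (fun x => (legendreP l).eval (dot x (axis 2))) ω : ℝ) : ℂ) := by
  rw [pairing, ← integral_const_mul, ← integral_complex_ofReal, harmonicCoeff]
  congr 1 with x
  have hf : ((l.factorial : ℝ) / l.factorial) = 1 := div_self (by positivity)
  simp only [sphericalHarmonic, Int.natAbs_zero, pow_zero, Nat.sub_zero, Nat.add_zero, hf,
    mul_one, Function.iterate_zero, id, dot_axis, map_mul, Complex.conj_ofReal]
  push_cast
  ring

/-- The polynomial `∑_{ℓ ≤ L} b_ℓ L_ℓ` of a window `b` supported in `{0, …, L}`. -/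
noncomputable def windowPoly (b : ℕ → ℝ) (L : ℕ) : ℝ[X] :=
  ∑ l ∈ Finset.range (L + 1), C (b l) * legendreL l

lemma eval_windowPoly (b : ℕ → ℝ) (L : ℕ) (t : ℝ) :
    (windowPoly b L).eval t = ∑ l ∈ Finset.range (L + 1), b l * (legendreL l).eval t := by
  simp [windowPoly, eval_finsetSum]

lemma needletCoeff_eq_pairing {Ω : Type*} {b : ℕ → ℝ} {L : ℕ} (hb : ∀ l, L < l → b l = 0)
    (c : S2) {w : ℝ} (hw : 0 < w) (X : S2 → Ω → ℝ) :
    needletCoeff b c w X = pairing X fun x => (windowPoly b L).eval (dot x c) := by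
  funext ω
  have hn : ∀ x, needlet b c w x = √w * (windowPoly b L).eval (dot x c) := by
    intro x
    rw [needlet, eval_windowPoly, tsum_eq_sum]
    intro l hl
    rw [hb l (by simpa [Nat.lt_succ_iff] using hl), zero_mul]
  have hw' : √w ≠ 0 := (Real.sqrt_pos.mpr hw).ne'
  simp only [needletCoeff, hn, pairing, ← integral_const_mul]
  congr 1 with x
  field_simp

variable {Ω : Type*} [MeasurableSpace Ω] {P : Measure Ω} {X : S2 → Ω → ℝ}
  [IsProbabilityMeasure P]

/-- The power spectrum is the sequence of eigenvalues of the covariance operator. -/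
lemma integral_covKernel_mul_legendreL (hX : IsStationaryField P X) (l : ℕ) (y c : S2) :
    ∫ x, covKernel P X x y * (legendreL l).eval (dot x c) ∂sphereMeasure =
      powerSpectrum P X l * (legendreL l).eval (dot y c) := by
  obtain ⟨a, ha⟩ := exists_integral_kernel_mul_legendreP (covKernel_rotate hX) covKernel_comm
    (continuous_covKernel hX) l
  have hpos : 0 < (2 * (l : ℝ) + 1) / (4 * Real.pi) := by positivity
  -- The squared normalization `(2ℓ + 1) / (4π)` of `Y_{ℓ,0}` cancels the squared norm of the zonal
  -- `P_ℓ`, so `E|a_{ℓ,0}|²` is the eigenvalue itself.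
  have hC : powerSpectrum P X l = a := by
    have hf := continuous_eval_dot (legendreP l) (axis 2)
    have hsq : ∀ ω, ‖harmonicCoeff X l 0 ω‖ ^ 2 = (2 * (l : ℝ) + 1) / (4 * Real.pi) *
        (pairing X (fun x => (legendreP l).eval (dot x (axis 2))) ω *
          pairing X (fun x => (legendreP l).eval (dot x (axis 2))) ω) := by
      intro ω
      rw [harmonicCoeff_zero, Complex.norm_real, Real.norm_eq_abs, sq_abs, mul_pow,
        Real.sq_sqrt hpos.le, sq (pairing _ _ _)]
    simp only [powerSpectrum, hsq]
    rw [integral_const_mul, integral_pairing_mul_pairing hX hf hf]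
    simp only [ha, mul_assoc]
    rw [integral_const_mul, integral_legendreP_mul_legendreP, if_pos rfl, dot_self,
      legendreP_eval_one]
    have : (2 * (l : ℝ) + 1) ≠ 0 := by positivity
    field_simp
  rw [hC]
  simp only [eval_legendreL, mul_left_comm _ ((2 * (l : ℝ) + 1) / (4 * Real.pi)),
    integral_const_mul, ha]

lemma integral_pairing_windowPoly (hX : IsStationaryField P X) (b : ℕ → ℝ) (L : ℕ) (c c' : S2) :
    ∫ ω, pairing X (fun x => (windowPoly b L).eval (dot x c)) ω *
        pairing X (fun x => (windowPoly b L).eval (dot x c')) ω ∂P =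
      ∑ l ∈ Finset.range (L + 1),
        b l ^ 2 * powerSpectrum P X l * (legendreL l).eval (dot c c') := by
  rw [integral_pairing_mul_pairing hX (continuous_eval_dot _ _) (continuous_eval_dot _ _)]
  have hK : ∀ y, Continuous fun x => covKernel P X x y := fun y =>
    (continuous_covKernel hX).comp (Continuous.prodMk continuous_id continuous_const)
  have hop : ∀ y, ∫ x, covKernel P X x y * (windowPoly b L).eval (dot x c) ∂sphereMeasure =
      ∑ l ∈ Finset.range (L + 1), b l * (powerSpectrum P X l * (legendreL l).eval (dot y c)) := by
    intro y
    simp only [eval_windowPoly, Finset.mul_sum]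
    have hcont : ∀ l, Continuous fun x => covKernel P X x y * (b l * (legendreL l).eval (dot x c)) :=
      fun l => (hK y).mul (continuous_const.mul (continuous_eval_dot _ _))
    rw [integral_finsetSum _ fun l _ => integrable_of_continuous (hcont l)]
    refine Finset.sum_congr rfl fun l _ => ?_
    simp only [mul_left_comm _ (b l)]
    rw [integral_const_mul, integral_covKernel_mul_legendreL hX]
  simp only [hop]
  simp only [eval_windowPoly, Finset.sum_mul_sum]
  have hterm : ∀ (l m : ℕ) (y : S2),
      b l * (powerSpectrum P X l * (legendreL l).eval (dot y c)) *
        (b m * (legendreL m).eval (dot y c')) =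
      (b l * powerSpectrum P X l * b m) *
        ((legendreL l).eval (dot y c) * (legendreL m).eval (dot y c')) := fun l m y => by ring
  simp only [hterm]
  have hcont : ∀ l m, Continuous fun y => (b l * powerSpectrum P X l * b m) *
      ((legendreL l).eval (dot y c) * (legendreL m).eval (dot y c')) := fun l m =>
    continuous_const.mul ((continuous_eval_dot _ _).mul (continuous_eval_dot _ _))
  rw [integral_finsetSum _ fun l _ => integrable_of_continuous
    (continuous_finsetSum _ fun m _ => hcont l m)]
  refine Finset.sum_congr rfl fun l hl => ?_
  rw [integral_finsetSum _ fun m _ => integrable_of_continuous (hcont l m)]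
  simp only [integral_const_mul, integral_legendreL_mul_legendreL, mul_ite, mul_zero]
  -- Orthogonality of different degrees keeps only `m = l`.
  rw [Finset.sum_ite_eq, if_pos hl]
  ring

end NeedletCoefficients

end Needlet

theorem proposition3 {Ω : Type*} [MeasurableSpace Ω] (P : Measure Ω) [IsProbabilityMeasure P]
    (X : Needlet.S2 → Ω → ℝ) (hX : Needlet.IsStationaryField P X)
    (b : ℕ → ℕ → ℝ) (L : ℕ → ℕ) (hb : ∀ j l, L j < l → b j l = 0)
    (N : ℕ → ℕ) (ξ : (j : ℕ) → Fin (N j) → Needlet.S2)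
    (w : (j : ℕ) → Fin (N j) → ℝ) (hw : ∀ j k, 0 < w j k) :
    (∀ j k, MemLp (Needlet.needletCoeff (b j) (ξ j k) (w j k) X) 2 P ∧
      ∫ ω, Needlet.needletCoeff (b j) (ξ j k) (w j k) X ω ∂P = 0) ∧
    ∀ j k k',
      covariance (Needlet.needletCoeff (b j) (ξ j k) (w j k) X)
          (Needlet.needletCoeff (b j) (ξ j k') (w j k') X) P =
        ∑' l : ℕ, b j l ^ 2 * Needlet.powerSpectrum P X l *
          (Needlet.legendreL l).eval (Needlet.dot (ξ j k) (ξ j k')) := by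
  have hmain : ∀ j k, MemLp (Needlet.needletCoeff (b j) (ξ j k) (w j k) X) 2 P ∧
      ∫ ω, Needlet.needletCoeff (b j) (ξ j k) (w j k) X ω ∂P = 0 := by
    intro j k
    rw [Needlet.needletCoeff_eq_pairing (hb j) (ξ j k) (hw j k) X]
    exact ⟨Needlet.memLp_pairing hX (Needlet.continuous_eval_dot _ _),
      Needlet.integral_pairing hX (Needlet.continuous_eval_dot _ _)⟩
  refine ⟨hmain, fun j k k' => ?_⟩
  rw [covariance_eq_sub (hmain j k).1 (hmain j k').1, (hmain j k).2, zero_mul, sub_zero,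
    Needlet.needletCoeff_eq_pairing (hb j) (ξ j k) (hw j k) X,
    Needlet.needletCoeff_eq_pairing (hb j) (ξ j k') (hw j k') X,
    tsum_eq_sum (s := Finset.range (L j + 1))]
  · exact Needlet.integral_pairing_windowPoly hX (b j) (L j) (ξ j k) (ξ j k')
  · intro l hl
    rw [hb j l (by simpa [Nat.lt_succ_iff] using hl)]
    ring
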